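/- All graphs are finite and simple. The double star $S_{a,b}$ consists of an edge $uv$ together with $a$ leaves attached to $u$ and $b$ leaves attached to $v$. $\mathrm{ex}(n,F)$ is the maximum number of edges of an $n$-vertex graph that does not contain $F$ as a (not necessarily induced) subgraph, and an $n$-vertex $F$-free graph with $\mathrm{ex}(n,F)$ edges is called extremal for $\mathrm{ex}(n,F)$. $kG$ denotes $k$ vertex-disjoint copies of $G$, and $\cup$ denotes vertex-disjoint union. A graph on $m$ vertices is near $r$-regular if it is $r$-regular when $rm$ is even, and if it has $m-1$ vertices of degree $r$ and one vertex of degree $r-1$ when $rm$ is odd. **Theorem.** Let $n,b$ be natural numbers with $b>3$ and $n\ge b+5$, and write $n=p(b+4)+q$ with integers $p\ge 0$ and $0\le q\le b+3$. 1. If $b\ge 24$ and $4\le q\le b-4$, or $16\le b\le 23$ and $5\le q\le b-4$, or $14\le b\le 15$ and $6\le q\le b-5$, then $$\mathrm{ex}(n,S_{3,b})=(p-1)\binom{b+4}{2}+\left\lfloor\frac{b(b+4+q)}{2}\right\rfloor ;$$ near $b$-regular graphs on $b+4+q$ vertices exist, and for every such graph $L$ the graph $(p-1)K_{b+4}\cup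 L$ is extremal for $\mathrm{ex}(n,S_{3,b})$. 2. If $b\ge 22$ and $q=b-3$, then $$\mathrm{ex}(n,S_{3,b})=(p-1)\binom{b+4}{2}+\left\lfloor\frac{b(2b+1)+3}{2}\right\rfloor ,$$ and there is a graph $L$ on $2b+1$ vertices with maximum degree $b+1$ such that $(p-1)K_{b+4}\cup L$ is extremal for $\mathrm{ex}(n,S_{3,b})$. 3. If $b\ge 34$ and $q=b-2$, then $$\mathrm{ex}(n,S_{3,b})=(p-1)\binom{b+4}{2}+\left\lfloor\frac{b(2b+2)+2+\lfloor b/2\rfloor}{2}\right\rfloor ,$$ and there is a graph $L$ on $2b+2$ vertices with maximum degree $b+1$ such that $(p-1)K_{b+4}\cup L$ is extremal for $\mathrm{ex}(n,S_{3,b})$. 4. In all other cases, $$\mathrm{ex}(n,S_{3,b})=p\binom{b+4}{2}+\binom{q}{2},$$ and $pK_{b+4}\cup K_q$ is extremal for $\mathrm{ex}(n,S_{3,b})$. -/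

import Mathlib

/-- The vertices of the double star: the two centers `u`, `v`, the `a` leaves at `u` and the `b`
leaves at `v`. -/
inductive DoubleStarVertex (a b : ℕ) : Type
  | u : DoubleStarVertex a b
  | v : DoubleStarVertex a b
  | leafU (i : Fin a) : DoubleStarVertex a b
  | leafV (j : Fin b) : DoubleStarVertex a b

/-- One orientation of each edge of the double star: the central edge `uv`, the edges from `u` to
its `a` leaves, the edges from `v` to its `b` leaves. -/
inductive DoubleStarEdge (a b : ℕ) : DoubleStarVertex a b → DoubleStarVertex a b → Prop
  | central : DoubleStarEdge a b .u .v
  | atU (i : Fin a) : DoubleStarEdge a b .u (.leafU i)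
  | atV (j : Fin b) : DoubleStarEdge a b .v (.leafV j)

/-- The double star `S_{a,b}`. -/
def doubleStar (a b : ℕ) : SimpleGraph (DoubleStarVertex a b) :=
  SimpleGraph.fromRel (DoubleStarEdge a b)

/-- `kG`: the disjoint union of `k` copies of `G`. -/
def disjointCopies {V : Type*} (k : ℕ) (G : SimpleGraph V) : SimpleGraph (Fin k × V) where
  Adj x y := x.1 = y.1 ∧ G.Adj x.2 y.2
  symm := ⟨fun _ _ h => ⟨h.1.symm, h.2.symm⟩⟩
  loopless := ⟨fun _ h => G.irrefl h.2⟩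

/-- A near `r`-regular graph on `m` vertices: `r`-regular if `r * m` is even, otherwise `m - 1`
vertices have degree `r` and one vertex has degree `r - 1`. (If `r * m` is odd then `1 ≤ r`.) -/
def IsNearRegular {V : Type*} [Fintype V] (G : SimpleGraph V) [DecidableRel G.Adj] (r : ℕ) :
    Prop :=
  (Even (r * Fintype.card V) → ∀ w, G.degree w = r) ∧
  (¬ Even (r * Fintype.card V) → ∃ x, G.degree x = r - 1 ∧ ∀ w, w ≠ x → G.degree w = r)

/-- `G ∈ Ex(n, F)`: `G` is an `F`-free graph on `n` vertices with `ex(n, F)` edges. -/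
def IsExtremalGraph {V W : Type*} [Fintype V] (n : ℕ) (F : SimpleGraph W) (G : SimpleGraph V) :
    Prop :=
  Fintype.card V = n ∧ F.Free G ∧ G.edgeSet.ncard = SimpleGraph.extremalNumber n F

/-- The pairs `(b, q)` for which the near `b`-regular construction gives the Turán number of
`S_{3,b}`. -/
def NearRegularRange (b q : ℕ) : Prop :=
  (24 ≤ b ∧ 4 ≤ q ∧ q ≤ b - 4) ∨
  (16 ≤ b ∧ b ≤ 23 ∧ 5 ≤ q ∧ q ≤ b - 4) ∨
  (14 ≤ b ∧ b ≤ 15 ∧ 6 ≤ q ∧ q ≤ b - 5)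

/-!
A graph `G` contains no `S_{3,b}` if and only if for every edge `uv` with `d(u) ≥ 4` and `d(v) ≥ b + 1`
the neighbourhoods of `u` and `v` cover at most `b + 4` vertices (`doubleStar_free_iff`). In
particular a vertex `x` adjacent to a vertex `v` of degree `b + 1 + i` has at most `2 - i`
neighbours outside of `N[v]`, unless `x` has degree at most `3`.

Upper bound. If some `b + 4` vertices meet at most `(b + 4).choose 2` edges (`Reducible`), they
can be deleted, and induction applies. A vertex `v` of degree at least `b + 2` yields such a set:
it consists of neighbours of `v` if `d(v) ≥ b + 4`, and of `N[v]` and possibly one more vertex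
otherwise. So let `G` be irreducible; then its maximum degree is at most `b + 1`. If `G` has at
least `2 * (b + 4)` vertices, this crude bound on the degrees suffices. Otherwise `G` has
`b + 4 + q` vertices. Let `v` be a vertex of degree `b + 1`, and let `s` be the number of vertices of
degree `b + 1` in `N[v]`. Irreducibility has two consequences. Vertices of degree `b + 1` in
`N[v]` have no neighbours outside of `N[v]` (`mem_of_adj_adj`), so that few edges leave `N[v]`;
this bounds the number of edges from above by a decreasing function of `s`
(`twiceMeeting_add_le`). And a common neighbour of two non-adjacent vertices of degree `b + 1` has
degree at most `b / 2` (`two_mul_degree_le`); since for `q < b` any two such vertices have a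
common neighbour, the vertices of degree `b + 1` outside of `N[v]` are paid for by these low
degrees, and the degree sum is at most `b * (b + 4 + q) + s` (`sum_degrees_le`). Balancing the two
bounds over `s` gives the claimed values (`le_twoBlockNumber`).

Lower bound. Near `b`-regular graphs contain no `S_{3,b}` as their degrees are at most `b`; they
exist by a circulant construction. For `q = b - 3` and `q = b - 2` equality in the two bounds
above dictates the graph: `s` closed twins of degree `b + 1`, joined to a set in which each vertex
has at most two neighbours further outside, and these neighbours form a clique (`cliqueChain`).
-/

/-! ### Arithmetic of the claimed values -/

/-- The Turán number of `S_{3,b}` on `b + 4 + q` vertices, `q ≤ b + 3`. -/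
noncomputable def twoBlockNumber (b q : ℕ) : ℕ :=
  open Classical in
  if NearRegularRange b q then b * (b + 4 + q) / 2
  else if 22 ≤ b ∧ q = b - 3 then (b * (2 * b + 1) + 3) / 2
  else if 34 ≤ b ∧ q = b - 2 then (b * (2 * b + 2) + 2 + b / 2) / 2
  else (b + 4).choose 2 + q.choose 2

/-- The Turán number of `S_{3,b}` on `p * (b + 4) + q` vertices, `q ≤ b + 3`. -/
noncomputable def turanValue (b q : ℕ) : ℕ → ℕ
  | 0 => q.choose 2
  | p + 1 => p * (b + 4).choose 2 + twoBlockNumber b q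

theorem two_mul_choose_two (m : ℕ) : 2 * m.choose 2 = m * (m - 1) := by
  rw [Nat.choose_two_right, Nat.mul_div_cancel' (Nat.even_mul_pred_self m).two_dvd]

theorem two_mul_choose_two_add_four (b : ℕ) : 2 * (b + 4).choose 2 = (b + 4) * (b + 3) := by
  rw [two_mul_choose_two]; rfl

theorem int_two_mul_choose_two (m : ℕ) : (2 * m.choose 2 : ℤ) = m * (m - 1) := by
  have h := two_mul_choose_two m
  rcases m with - | m
  · simp
  · simp only [Nat.add_sub_cancel] at h
    zify at h
    push_cast
    linarith

theorem int_two_mul_choose_two_add_four (b : ℕ) :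
    (2 * (b + 4).choose 2 : ℤ) = (b + 4) * (b + 3) := by
  exact_mod_cast two_mul_choose_two_add_four b

/-- In the near regular range a near `b`-regular graph has at least as many edges as
`K_{b+4} ∪ K_q`. -/
theorem NearRegularRange.three_mul_le {b q : ℕ} (h : NearRegularRange b q) :
    (3 * (b + 4) : ℤ) ≤ q * (b + 1 - q) := by
  rcases h with ⟨h1, h2, h3⟩ | ⟨h1, h2, h3, h4⟩ | ⟨h1, h2, h3, h4⟩
  · have : (q : ℤ) ≤ b - 4 := by omega
    nlinarith
  · have : (q : ℤ) ≤ b - 4 := by omega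
    nlinarith
  · have : (q : ℤ) ≤ b - 5 := by omega
    nlinarith

/-- Outside of the ranges where another graph is extremal, a near `b`-regular graph has at most as
many edges as `K_{b+4} ∪ K_q`, up to rounding. -/
theorem mul_le_of_not_nearRegularRange {b q : ℕ} (hb : 3 < b) (hq : q ≤ b + 3)
    (h : ¬ NearRegularRange b q) (h2 : ¬ (22 ≤ b ∧ q = b - 3)) :
    (q * (b + 1 - q) : ℤ) ≤ 3 * (b + 4) + 1 := by
  unfold NearRegularRange at h
  by_cases h14 : b ≤ 15
  · have : q ≤ 18 := by omega
    interval_cases b <;> interval_cases q <;> omega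
  · push Not at h14
    by_cases h4 : q ≤ 4
    · interval_cases q <;> push_cast <;> omega
    · by_cases h5 : q ≤ b - 4
      · omega
      · have : (b : ℤ) - 3 ≤ q := by omega
        have h16 : (16 : ℤ) ≤ b := by omega
        rcases this.eq_or_lt with h' | h'
        · rw [← h']
          have : (b : ℤ) < 22 := by omega
          linarith
        · have : (b : ℤ) - 2 ≤ q := by omega
          nlinarith

theorem choose_add_choose_le_twoBlockNumber {b q : ℕ} (hq : q ≤ b + 3) :
    (b + 4).choose 2 + q.choose 2 ≤ twoBlockNumber b q := by
  have e1 := int_two_mul_choose_two_add_four b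
  have e2 := int_two_mul_choose_two q
  unfold twoBlockNumber
  split_ifs with h1 h2 h3
  · rw [Nat.le_div_iff_mul_le two_pos]
    zify
    linarith [h1.three_mul_le]
  · rw [Nat.le_div_iff_mul_le two_pos]
    have : (q : ℤ) = b - 3 := by omega
    rw [this] at e2
    have : (22 : ℤ) ≤ b := by omega
    zify
    linarith
  · rw [Nat.le_div_iff_mul_le two_pos]
    have : (q : ℤ) = b - 2 := by omega
    rw [this] at e2
    have : (16 : ℤ) ≤ (b / 2 : ℕ) := by omega
    zify at this ⊢
    linarith
  · exact le_rfl

theorem mul_le_two_mul_twoBlockNumber {b q : ℕ} (hb : 3 < b) (hq : q ≤ b + 3) :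
    b * (b + 4 + q) ≤ 2 * twoBlockNumber b q + 1 := by
  have e1 := int_two_mul_choose_two_add_four b
  have e2 := int_two_mul_choose_two q
  unfold twoBlockNumber
  split_ifs with h1 h2 h3
  · omega
  · have h : b * (b + 4 + q) = b * (2 * b + 1) := by congr 1; omega
    omega
  · have h : b * (b + 4 + q) = b * (2 * b + 2) := by congr 1; omega
    omega
  · have := mul_le_of_not_nearRegularRange hb hq h1 h2
    zify
    linarith

/-- The numerical core of the upper bound on `b + 4 + q` vertices: `e` is the number of edges and
`s` the number of vertices of degree `b + 1` in the closed neighbourhood of one of them. -/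
theorem le_twoBlockNumber {b q e s : ℕ} (hb : 3 < b) (hq : q ≤ b + 3)
    (hs : s ≤ b + 2) (hs1 : 1 ≤ s)
    (h1 : 2 * e ≤ (b + 1) * (b + 4 + q))
    (h2 : 2 * e + s ≤ (b + 2) * (b + 2) + (q + 2) * (q + 1))
    (h3 : q + 1 ≤ b → 2 * e ≤ b * (b + 4 + q) + s) :
    e ≤ twoBlockNumber b q := by
  have e1 := int_two_mul_choose_two_add_four b
  have e2 := int_two_mul_choose_two q
  unfold twoBlockNumber
  split_ifs with c1 c2 c3
  · rw [Nat.le_div_iff_mul_le two_pos]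
    have : (q : ℤ) ≤ b - 4 ∧ (4 : ℤ) ≤ q ∧ (14 : ℤ) ≤ b := by
      unfold NearRegularRange at c1; omega
    obtain ⟨i1, i2, i3⟩ := this
    zify at *
    nlinarith
  · have h3 := h3 (by omega)
    have hqb : (q : ℤ) = b - 3 := by omega
    rw [Nat.le_div_iff_mul_le two_pos]
    zify at *
    rw [hqb] at h2 h3
    nlinarith
  · have h3 := h3 (by omega)
    have hqb : (q : ℤ) = b - 2 := by omega
    have hq' : b + 4 + q = 2 * b + 2 := by omega
    rw [hq'] at h3
    rw [Nat.le_div_iff_mul_le two_pos]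
    have h4 : 2 * e + s ≤ b * (2 * b + 2) + b + 4 := by
      zify at *
      rw [hqb] at h2
      nlinarith
    omega
  · have key := mul_le_of_not_nearRegularRange hb hq c1 c2
    have goal : 2 * (e : ℤ) ≤ (b + 4) * (b + 3) + q * (q - 1) + 1 := by
      rcases Nat.lt_or_ge q b with hqb | hqb
      · have h3 := h3 (by omega)
        by_cases h4 : 4 * q ≤ 3 * b + 8
        · zify at *
          nlinarith
        by_cases h15 : b ≤ 15
        · have : q ≤ 15 := by omega
          interval_cases b <;> interval_cases q <;> omega
        -- Outside of the near regular range, the remaining `q` are `b - 3`, `b - 2`, `b - 1`.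
        have : q = b - 3 ∨ q = b - 2 ∨ q = b - 1 := by
          unfold NearRegularRange at c1; omega
        zify at h2 h3 h1
        rcases this with h | h | h
        · have hb' : (b : ℤ) ≤ 21 := by omega
          have hqb : (q : ℤ) = b - 3 := by omega
          rw [hqb] at h2 h3 ⊢
          nlinarith
        · have hb' : (b : ℤ) ≤ 33 := by omega
          have hqb : (q : ℤ) = b - 2 := by omega
          rw [hqb] at h2 h3 ⊢
          nlinarith
        · have hqb : (q : ℤ) = b - 1 := by omega
          rw [hqb] at h2 h3 ⊢
          have : (s : ℤ) ≤ b + 2 := by omega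
          nlinarith
      · zify at *
        nlinarith
    -- Both `2 * e` and twice the claimed value are even, so the additional `1` is harmless.
    zify
    omega

/-! ### Edges meeting a set, and deletable sets -/

open Finset in
/-- Twice the number of edges of `G` that meet `A`: an edge with exactly one end in `A` is counted
by the degree of this end and again by the set difference. -/
def SimpleGraph.twiceMeeting {V : Type*} [Fintype V] [DecidableEq V] (G : SimpleGraph V)
    [DecidableRel G.Adj] (A : Finset V) : ℕ :=
  ∑ x ∈ A, (G.degree x + #(G.neighborFinset x \ A))

/-- For every edge `uv` with `d(u) ≥ 4` and `d(v) ≥ b + 1`, the two neighbourhoods cover at most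
`b + 4` vertices; `u` and `v` are among these. By Hall's condition for the leaves this says that
`G` contains no `S_{3,b}`, see `doubleStar_free_iff`. -/
def SimpleGraph.SmallEdgeNeighborhoods {V : Type*} [Fintype V] [DecidableEq V] (G : SimpleGraph V)
    [DecidableRel G.Adj] (b : ℕ) : Prop :=
  ∀ u v, G.Adj u v → 4 ≤ G.degree u → b + 1 ≤ G.degree v →
    (G.neighborFinset u ∪ G.neighborFinset v).card ≤ b + 4

namespace SimpleGraph

open Finset

section Meeting

variable {V : Type*} [Fintype V] [DecidableEq V] {G : SimpleGraph V} [DecidableRel G.Adj]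

theorem card_sdiff_add_card_inter_neighborFinset (x : V) (A : Finset V) :
    #(G.neighborFinset x \ A) + #(G.neighborFinset x ∩ A) = G.degree x := by
  rw [card_sdiff_add_card_inter, card_neighborFinset_eq_degree]

theorem sum_card_neighborFinset_inter_comm (A B : Finset V) :
    ∑ x ∈ A, #(G.neighborFinset x ∩ B) = ∑ x ∈ B, #(G.neighborFinset x ∩ A) := by
  have h := sum_card_bipartiteAbove_eq_sum_card_bipartiteBelow (s := A) (t := B) G.Adj
  have h1 (x) : G.neighborFinset x ∩ B = bipartiteAbove G.Adj B x := by
    ext y; simp [bipartiteAbove, and_comm]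
  have h2 (x) : G.neighborFinset x ∩ A = bipartiteBelow G.Adj A x := by
    ext y; simp [bipartiteBelow, and_comm, G.adj_comm]
  simp only [h1, h2, h]

theorem degree_induce_compl (A : Finset V) (x : V) (hx : x ∉ A) :
    (G.induce {x | x ∉ A}).degree ⟨x, hx⟩ = #(G.neighborFinset x \ A) := by
  rw [← card_neighborFinset_eq_degree, ← card_map (Function.Embedding.subtype _)]
  congr 1
  ext y
  simp

theorem two_mul_card_edgeFinset_eq_twiceMeeting_add (A : Finset V) :
    2 * #G.edgeFinset = G.twiceMeeting A + 2 * #(G.induce {x | x ∉ A}).edgeFinset := by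
  rw [← sum_degrees_eq_twice_card_edges, ← sum_degrees_eq_twice_card_edges]
  have h1 : ∑ x : {x | x ∉ A}, (G.induce {x | x ∉ A}).degree x
      = ∑ x ∈ Aᶜ, #(G.neighborFinset x \ A) := by
    rw [Finset.sum_subtype (p := (· ∈ {x | x ∉ A})) Aᶜ (by simp)]
    exact Finset.sum_congr rfl fun x _ => degree_induce_compl A x.1 x.2
  have h2 : ∑ x ∈ A, #(G.neighborFinset x \ A) = ∑ x ∈ Aᶜ, #(G.neighborFinset x ∩ A) := by
    rw [sum_card_neighborFinset_inter_comm]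
    simp [sdiff_eq_inter_compl]
  rw [h1, twiceMeeting, sum_add_distrib, h2, ← sum_add_sum_compl A, add_assoc, ← sum_add_distrib]
  congr 1
  refine Finset.sum_congr rfl fun x _ => ?_
  rw [add_comm, card_sdiff_add_card_inter_neighborFinset]

theorem twiceMeeting_insert (A : Finset V) (w : V) (hw : w ∉ A) :
    G.twiceMeeting (insert w A) = G.twiceMeeting A + 2 * #(G.neighborFinset w \ A) := by
  have h1 : ∑ x ∈ A, #(G.neighborFinset x \ A)
      = ∑ x ∈ A, #(G.neighborFinset x \ insert w A) + #(G.neighborFinset w ∩ A) := by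
    have : #(G.neighborFinset w ∩ A) = ∑ x ∈ A, #(G.neighborFinset x ∩ {w}) := by
      rw [sum_card_neighborFinset_inter_comm]; simp
    rw [this, ← sum_add_distrib]
    refine Finset.sum_congr rfl fun x _ => ?_
    rw [← card_union_of_disjoint]
    · congr 1
      ext y
      simp only [mem_sdiff, mem_union, mem_inter, mem_insert, mem_singleton]
      by_cases h : y = w
      · subst h; simp [hw]
      · simp [h]
    · rw [Finset.disjoint_left]; simp; tauto
  have h2 : G.neighborFinset w \ insert w A = G.neighborFinset w \ A := by
    ext y
    simp only [mem_sdiff, mem_insert, mem_neighborFinset]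
    constructor
    · tauto
    · rintro ⟨h, h'⟩
      exact ⟨h, by rintro (rfl | h''); exacts [G.irrefl h, h' h'']⟩
  have h3 := card_sdiff_add_card_inter_neighborFinset (G := G) w A
  simp only [twiceMeeting]
  rw [sum_insert hw, h2, sum_add_distrib, sum_add_distrib, h1]
  omega

theorem twiceMeeting_insert_insert_le (A : Finset V) (w w' : V) (hw : w ∉ A)
    (hw' : w' ∉ insert w A) :
    G.twiceMeeting (insert w' (insert w A)) ≤
      G.twiceMeeting A + 2 * #(G.neighborFinset w \ A) + 2 * #(G.neighborFinset w' \ A) := by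
  rw [twiceMeeting_insert _ _ hw', twiceMeeting_insert _ _ hw]
  gcongr
  exact subset_insert w A

end Meeting

section Reduction

variable {V : Type*} [Fintype V] [DecidableEq V] {G : SimpleGraph V} [DecidableRel G.Adj] {b : ℕ}

/-- Some `b + 4` vertices meet at most as many edges as `K_{b+4}` has. Deleting them loses no more
than one copy of `K_{b+4}`, so that induction applies. -/
def Reducible (G : SimpleGraph V) [DecidableRel G.Adj] (b : ℕ) : Prop :=
  ∃ S : Finset V, #S = b + 4 ∧ G.twiceMeeting S ≤ (b + 4) * (b + 3)

theorem card_insert_neighborFinset (v : V) :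
    #(insert v (G.neighborFinset v)) = G.degree v + 1 := by
  rw [card_insert_of_notMem (by simp), card_neighborFinset_eq_degree]

theorem card_sdiff_closed_neighborhood_lt {v x : V} (hvx : G.Adj v x) :
    #(G.neighborFinset x \ insert v (G.neighborFinset v)) < G.degree x := by
  rw [← card_neighborFinset_eq_degree]
  refine card_lt_card ⟨sdiff_subset, fun h => ?_⟩
  have := h ((mem_neighborFinset _ _ _).2 hvx.symm)
  simp at this

/-- A neighbour of a vertex of degree at least `b + 1` has few neighbours outside of the closed
neighbourhood of this vertex. -/
theorem SmallEdgeNeighborhoods.card_sdiff_le (h : G.SmallEdgeNeighborhoods b) {v x : V}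
    (hvx : G.Adj v x) (hv : b + 1 ≤ G.degree v) (hx : 4 ≤ G.degree x) :
    #(G.neighborFinset x \ insert v (G.neighborFinset v)) + (G.degree v + 1) ≤ b + 4 := by
  rw [← card_insert_neighborFinset, card_sdiff_add_card]
  refine le_trans (card_le_card ?_) (h x v hvx.symm hx hv)
  intro y
  simp only [mem_union, mem_insert, mem_neighborFinset]
  rintro (h | rfl | h)
  exacts [.inl h, .inl hvx.symm, .inr h]

theorem twiceMeeting_closed_neighborhood_le {v : V} {m : ℕ}
    (h : ∀ x, G.Adj v x →
      G.degree x + #(G.neighborFinset x \ insert v (G.neighborFinset v)) ≤ m) :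
    G.twiceMeeting (insert v (G.neighborFinset v)) ≤ G.degree v + G.degree v * m := by
  rw [twiceMeeting, sum_insert (by simp)]
  have : G.neighborFinset v \ insert v (G.neighborFinset v) = ∅ := by
    rw [sdiff_eq_empty_iff_subset]; exact subset_insert _ _
  rw [this, card_empty, add_zero]
  gcongr
  rw [← card_neighborFinset_eq_degree, ← smul_eq_mul]
  exact sum_le_card_nsmul _ _ _ fun x hx => h x ((mem_neighborFinset _ _ _).1 hx)

/-- If `w ∉ N[v]` has a neighbour `x ∈ N(v)` of degree at least `b + 1`, then `w` has few neighbours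
outside of `N[v]`. -/
theorem SmallEdgeNeighborhoods.card_sdiff_le_of_adj_adj (h : G.SmallEdgeNeighborhoods b)
    {v x w : V} (hvx : G.Adj v x) (hxw : G.Adj x w) (hw : w ∉ insert v (G.neighborFinset v))
    (hx : b + 1 ≤ G.degree x) :
    #(G.neighborFinset w \ insert v (G.neighborFinset v)) ≤
      max 2 (b + 2 - G.degree x + #(G.neighborFinset x \ insert v (G.neighborFinset v))) := by
  set A := insert v (G.neighborFinset v) with hA
  have hxA : x ∈ A := by simp [hA, hvx]
  rw [le_max_iff]
  by_cases hd : 4 ≤ G.degree w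
  · right
    have h1 := h w x hxw.symm hd hx
    have h2 : #((G.neighborFinset w \ A) \ G.neighborFinset x) + #(G.neighborFinset x)
        < #(G.neighborFinset w ∪ G.neighborFinset x) := by
      rw [card_sdiff_add_card]
      refine card_lt_card ⟨union_subset_union_left sdiff_subset, fun hs => ?_⟩
      have := hs (mem_union_left _ ((mem_neighborFinset _ _ _).2 hxw.symm))
      simp [hxA] at this
    have h3 : #((G.neighborFinset w \ A) ∩ G.neighborFinset x) < #(G.neighborFinset x \ A) := by
      refine card_lt_card ⟨fun y => by simp; tauto, fun hs => ?_⟩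
      have := hs (mem_sdiff.2 ⟨(mem_neighborFinset _ _ _).2 hxw, hw⟩)
      simp at this
    have h4 := card_sdiff_add_card_inter (G.neighborFinset w \ A) (G.neighborFinset x)
    rw [card_neighborFinset_eq_degree] at h2
    omega
  · left
    have : #(G.neighborFinset w \ A) < G.degree w := by
      rw [← card_neighborFinset_eq_degree]
      refine card_lt_card ⟨sdiff_subset, fun hs => ?_⟩
      have := hs ((mem_neighborFinset _ _ _).2 hxw.symm)
      simp [hxA] at this
    omega

theorem card_sdiff_neighborFinset_le_degree (w : V) (A : Finset V) :
    #(G.neighborFinset w \ A) ≤ G.degree w := by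
  rw [← card_neighborFinset_eq_degree]; exact card_le_card sdiff_subset

theorem reducible_of_insert {A : Finset V} {w : V} (hA : #A = b + 3) (hw : w ∉ A)
    (h : G.twiceMeeting A + 2 * #(G.neighborFinset w \ A) ≤ (b + 4) * (b + 3)) :
    G.Reducible b :=
  ⟨insert w A, by rw [card_insert_of_notMem hw, hA], by rwa [twiceMeeting_insert _ _ hw]⟩

/-- If the maximum degree is `b + 1`, then the last vertex that completes `A` and `w` to `b + 4`
vertices can be chosen arbitrarily. -/
theorem reducible_of_insert_insert {A : Finset V} {w : V} (hV : b + 4 ≤ Fintype.card V)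
    (hΔ : ∀ x, G.degree x ≤ b + 1) (hA : #A = b + 2) (hw : w ∉ A)
    (h : G.twiceMeeting A + 2 * #(G.neighborFinset w \ A) + 2 * (b + 1) ≤ (b + 4) * (b + 3)) :
    G.Reducible b := by
  have hc : #(insert w A) = b + 3 := by rw [card_insert_of_notMem hw, hA]
  obtain ⟨w', hw'⟩ : ∃ w', w' ∉ insert w A := by
    by_contra! hcon
    have := card_le_card (fun x _ => hcon x : (univ : Finset V) ⊆ insert w A)
    rw [card_univ] at this
    omega
  refine ⟨insert w' (insert w A), by rw [card_insert_of_notMem hw', hc], ?_⟩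
  have h1 := twiceMeeting_insert_insert_le (G := G) A w w' hw hw'
  have h2 := card_sdiff_neighborFinset_le_degree (G := G) w' A
  have h3 := hΔ w'
  omega

/-- All neighbours of a vertex of degree at least `b + 4` have degree at most `3`, so any `b + 4` of
them may be deleted. -/
theorem SmallEdgeNeighborhoods.reducible_of_add_four_le (h : G.SmallEdgeNeighborhoods b)
    (hb : 3 < b) {v : V} (hv : b + 4 ≤ G.degree v) : G.Reducible b := by
  rw [← card_neighborFinset_eq_degree] at hv
  obtain ⟨S, hS, hc⟩ := exists_subset_card_eq hv
  refine ⟨S, hc, ?_⟩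
  have : ∀ x ∈ S, G.degree x + #(G.neighborFinset x \ S) ≤ 6 := fun x hx => by
    have h1 := card_sdiff_neighborFinset_le_degree (G := G) x S
    by_contra! hcon
    have hvx := (mem_neighborFinset _ _ _).1 (hS hx)
    rw [card_neighborFinset_eq_degree] at hv
    have := h.card_sdiff_le hvx (by omega) (by omega)
    omega
  calc G.twiceMeeting S ≤ #S • 6 := sum_le_card_nsmul _ _ _ this
    _ ≤ (b + 4) * (b + 3) := by rw [hc, smul_eq_mul]; gcongr; omega

/-- The closed neighbourhood of a vertex of degree `b + 3` may be deleted. -/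
theorem SmallEdgeNeighborhoods.reducible_of_eq_add_three (h : G.SmallEdgeNeighborhoods b)
    (hb : 3 < b) (hΔ : ∀ x, G.degree x ≤ b + 3) {v : V} (hv : G.degree v = b + 3) :
    G.Reducible b := by
  refine ⟨insert v (G.neighborFinset v), by rw [card_insert_neighborFinset, hv], ?_⟩
  refine (twiceMeeting_closed_neighborhood_le (m := b + 3) fun x hx => ?_).trans
    (by rw [hv]; ring_nf; omega)
  have h1 := card_sdiff_closed_neighborhood_lt hx
  have h2 := hΔ x
  by_cases h4 : 4 ≤ G.degree x
  · have := h.card_sdiff_le hx (by omega) h4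
    omega
  · omega

/-- The closed neighbourhood of a vertex of degree `b + 2` may be deleted together with one further
vertex. This has to be chosen with care only if edges leave the neighbourhood from a vertex of
degree at least `b + 1`: then it is the other end of such an edge. -/
theorem SmallEdgeNeighborhoods.reducible_of_eq_add_two (h : G.SmallEdgeNeighborhoods b)
    (hb : 3 < b) (hV : b + 4 ≤ Fintype.card V) (hΔ : ∀ x, G.degree x ≤ b + 2) {v : V}
    (hv : G.degree v = b + 2) : G.Reducible b := by
  have hA : #(insert v (G.neighborFinset v)) = b + 3 := by rw [card_insert_neighborFinset, hv]
  have hout : ∀ x, G.Adj v x → 4 ≤ G.degree x →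
      #(G.neighborFinset x \ insert v (G.neighborFinset v)) ≤ 1 := fun x hx h4 => by
    have := h.card_sdiff_le hx (by omega) h4
    omega
  by_cases hcase : ∃ x w, G.Adj v x ∧ G.Adj x w ∧ w ∉ insert v (G.neighborFinset v) ∧
      b + 1 ≤ G.degree x
  · obtain ⟨x, w, hvx, hxw, hw, hx⟩ := hcase
    refine reducible_of_insert hA hw ?_
    have h1 := h.card_sdiff_le_of_adj_adj hvx hxw hw hx
    have h2 := hout x hvx (by omega)
    have h3 : G.twiceMeeting (insert v (G.neighborFinset v)) ≤ (b + 2) + (b + 2) * (b + 3) := by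
      rw [← hv]
      refine twiceMeeting_closed_neighborhood_le fun y hy => ?_
      have h4 := hout y hy
      have h5 := card_sdiff_closed_neighborhood_lt hy
      have := hΔ y
      by_cases 4 ≤ G.degree y <;> omega
    nlinarith [h1.trans (max_le (le_refl 2) (by omega))]
  · obtain ⟨w, hw⟩ : ∃ w, w ∉ insert v (G.neighborFinset v) := by
      by_contra! hcon
      have := card_le_card (fun x _ => hcon x : (univ : Finset V) ⊆ _)
      rw [card_univ] at this
      omega
    refine reducible_of_insert hA hw ?_
    have h3 : G.twiceMeeting (insert v (G.neighborFinset v)) ≤ (b + 2) + (b + 2) * (b + 2) := by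
      rw [← hv]
      refine twiceMeeting_closed_neighborhood_le fun y hy => ?_
      have h4 := hout y hy
      have h5 := card_sdiff_closed_neighborhood_lt hy
      have h6 := hΔ y
      by_cases h7 : b + 1 ≤ G.degree y
      · have : G.neighborFinset y \ insert v (G.neighborFinset v) = ∅ := by
          rw [eq_empty_iff_forall_notMem]
          intro z hz
          rw [mem_sdiff, mem_neighborFinset] at hz
          exact hcase ⟨y, z, hy, hz.1, hz.2, h7⟩
        rw [this, card_empty]
        omega
      · by_cases 4 ≤ G.degree y <;> omega
    have h1 := card_sdiff_neighborFinset_le_degree (G := G) w (insert v (G.neighborFinset v))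
    have h2 := hΔ w
    nlinarith

end Reduction

/-! ### The upper bound -/

section Irreducible

variable {V : Type*} [Fintype V] [DecidableEq V] {G : SimpleGraph V} [DecidableRel G.Adj] {b : ℕ}

theorem SmallEdgeNeighborhoods.card_sdiff_le_two (h : G.SmallEdgeNeighborhoods b) {v x : V}
    (hv : G.degree v = b + 1) (hvx : G.Adj v x) :
    #(G.neighborFinset x \ insert v (G.neighborFinset v)) ≤ 2 := by
  have h1 := card_sdiff_closed_neighborhood_lt hvx
  by_cases h4 : 4 ≤ G.degree x
  · have := h.card_sdiff_le hvx (by omega) h4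
    omega
  · omega

/-- In an irreducible graph, adjacent vertices of degree `b + 1` are closed twins. -/
theorem SmallEdgeNeighborhoods.mem_of_adj_adj (h : G.SmallEdgeNeighborhoods b)
    (hirr : ¬ G.Reducible b) (hV : b + 4 ≤ Fintype.card V)
    (hΔ : ∀ x, G.degree x ≤ b + 1) {v x w : V} (hv : G.degree v = b + 1) (hvx : G.Adj v x)
    (hx : G.degree x = b + 1) (hxw : G.Adj x w) : w ∈ insert v (G.neighborFinset v) := by
  by_contra hw
  refine hirr (reducible_of_insert_insert hV hΔ
    (by rw [card_insert_neighborFinset, hv]) hw ?_)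
  have h1 := h.card_sdiff_le_of_adj_adj hvx hxw hw hx.ge
  have h2 := h.card_sdiff_le_two hv hvx
  have h3 : G.twiceMeeting (insert v (G.neighborFinset v)) ≤ (b + 1) + (b + 1) * (b + 3) := by
    rw [← hv]
    refine twiceMeeting_closed_neighborhood_le fun y hy => ?_
    have h4 := h.card_sdiff_le_two hv hy
    have := hΔ y
    omega
  have h4 := h1.trans (max_le (by omega : 2 ≤ 3) (by omega))
  nlinarith

/-- The contribution of a vertex to `twiceMeeting` of the closed neighbourhood of a vertex of degree
`b + 1`. -/
theorem SmallEdgeNeighborhoods.degree_add_card_sdiff_le (h : G.SmallEdgeNeighborhoods b)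
    (hirr : ¬ G.Reducible b) (hV : b + 4 ≤ Fintype.card V)
    (hΔ : ∀ x, G.degree x ≤ b + 1) {v x : V} (hv : G.degree v = b + 1)
    (hx : x ∈ insert v (G.neighborFinset v)) :
    G.degree x + #(G.neighborFinset x \ insert v (G.neighborFinset v))
      + (if G.degree x = b + 1 then 1 else 0) ≤ b + 2 := by
  have h3 := hΔ x
  split_ifs with h1
  · have : G.neighborFinset x \ insert v (G.neighborFinset v) = ∅ := by
      rw [sdiff_eq_empty_iff_subset]
      rcases mem_insert.1 hx with rfl | hx
      · exact subset_insert _ _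
      · rw [mem_neighborFinset] at hx
        exact fun w hw => h.mem_of_adj_adj hirr hV hΔ hv hx h1 ((mem_neighborFinset _ _ _).1 hw)
    rw [this, card_empty]
    omega
  · rcases mem_insert.1 hx with rfl | hx
    · exact absurd hv h1
    · have h2 := h.card_sdiff_le_two hv ((mem_neighborFinset _ _ _).1 hx)
      omega

theorem SmallEdgeNeighborhoods.twiceMeeting_add_le (h : G.SmallEdgeNeighborhoods b)
    (hirr : ¬ G.Reducible b) (hV : b + 4 ≤ Fintype.card V)
    (hΔ : ∀ x, G.degree x ≤ b + 1) {v : V} (hv : G.degree v = b + 1) :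
    G.twiceMeeting (insert v (G.neighborFinset v))
      + #{x ∈ insert v (G.neighborFinset v) | G.degree x = b + 1} ≤ (b + 2) * (b + 2) := by
  rw [twiceMeeting, card_filter, ← sum_add_distrib]
  refine (sum_le_card_nsmul _ _ (b + 2) fun x hx =>
    h.degree_add_card_sdiff_le hirr hV hΔ hv hx).trans ?_
  rw [card_insert_neighborFinset, hv, smul_eq_mul]

/-- In an irreducible graph, a common neighbour of two non-adjacent vertices of degree `b + 1` has
degree at most `b / 2`: otherwise the two neighbourhoods share so much that the second vertex can
be added to the first closed neighbourhood at little cost. -/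
theorem SmallEdgeNeighborhoods.two_mul_degree_le (h : G.SmallEdgeNeighborhoods b)
    (hirr : ¬ G.Reducible b) (hV : b + 4 ≤ Fintype.card V)
    (hΔ : ∀ x, G.degree x ≤ b + 1) {v u w : V} (hv : G.degree v = b + 1) (hvu : G.Adj v u)
    (hw : G.degree w = b + 1) (hwu : G.Adj w u) (hwA : w ∉ insert v (G.neighborFinset v)) :
    2 * G.degree u ≤ b := by
  by_contra! hcon
  refine hirr (reducible_of_insert_insert hV hΔ
    (by rw [card_insert_neighborFinset, hv]) hwA ?_)
  have h1 := h.twiceMeeting_add_le hirr hV hΔ hv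
  have h2 : 1 ≤ #{x ∈ insert v (G.neighborFinset v) | G.degree x = b + 1} :=
    card_pos.2 ⟨v, by simp [hv]⟩
  set A := insert v (G.neighborFinset v) with hA
  set B := insert w (G.neighborFinset w) with hB
  have h3 : #(G.neighborFinset u \ A) ≤ 2 := h.card_sdiff_le_two hv hvu
  have h4 : #(G.neighborFinset u \ B) ≤ 2 := h.card_sdiff_le_two hw hwu
  have h5 : G.degree u ≤ #(G.neighborFinset u \ A) + #(G.neighborFinset u \ B)
      + #((G.neighborFinset w ∩ A).erase u) := by
    rw [← card_neighborFinset_eq_degree]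
    refine (card_le_card ?_).trans ((card_union_le _ _).trans
      (Nat.add_le_add_right (card_union_le _ _) _))
    intro y hy
    have hyu : y ≠ u := fun h => by subst h; simp at hy
    have hyw : y ∈ A → y ∈ B → y ∈ G.neighborFinset w := fun hyA hyB =>
      (mem_insert.1 hyB).resolve_left fun h => hwA (h ▸ hyA)
    simp only [mem_union, mem_sdiff, mem_erase, mem_inter]
    tauto
  have h6 : #((G.neighborFinset w ∩ A).erase u) + 1 = #(G.neighborFinset w ∩ A) :=
    card_erase_add_one (by simp [hA, hvu, hwu])
  have h7 := card_sdiff_add_card_inter_neighborFinset (G := G) w A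
  rw [hw] at h7
  nlinarith

/-- In an irreducible graph on at most `2b + 3` vertices, the surplus of the degree sum over that of
a `b`-regular graph is at most the number of vertices of degree `b + 1` in a single closed
neighbourhood. Any other vertex of degree `b + 1` is paid for by its common neighbours with the
center, whose degree is small. -/
theorem SmallEdgeNeighborhoods.sum_degrees_le (h : G.SmallEdgeNeighborhoods b) (hb : 3 < b)
    (hirr : ¬ G.Reducible b) (hV : b + 4 ≤ Fintype.card V) (hV' : Fintype.card V ≤ 2 * b + 3)
    (hΔ : ∀ x, G.degree x ≤ b + 1) {v : V} (hv : G.degree v = b + 1) :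
    ∑ x, G.degree x ≤ b * Fintype.card V
      + #{x ∈ insert v (G.neighborFinset v) | G.degree x = b + 1} := by
  set A := insert v (G.neighborFinset v) with hA
  have hcA : #A = b + 2 := by rw [card_insert_neighborFinset, hv]
  set T : Finset V := {x ∈ Aᶜ | G.degree x = b + 1} with hT
  have hout : ∑ x ∈ Aᶜ, G.degree x ≤ #Aᶜ * b + #T := by
    rw [hT, card_filter, ← smul_eq_mul, ← sum_const, ← sum_add_distrib]
    refine sum_le_sum fun x _ => ?_
    have := hΔ x
    split_ifs <;> omega
  -- By size, two closed neighbourhoods of vertices of degree `b + 1` intersect.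
  have hpay : #T ≤ ∑ x ∈ A, #(G.neighborFinset x ∩ T) := by
    rw [sum_card_neighborFinset_inter_comm, card_eq_sum_ones]
    refine sum_le_sum fun w hw => card_pos.2 ?_
    obtain ⟨hwA, hwd⟩ := mem_filter.1 hw
    rw [mem_compl] at hwA
    have h1 : (A ∩ insert w (G.neighborFinset w)).Nonempty := by
      rw [← card_pos]
      have h2 := card_union_add_card_inter A (insert w (G.neighborFinset w))
      have h3 := card_le_univ (A ∪ insert w (G.neighborFinset w))
      rw [hcA, card_insert_neighborFinset w, hwd] at h2
      omega
    obtain ⟨u, hu⟩ := h1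
    obtain ⟨hu1, hu2⟩ := mem_inter.1 hu
    refine ⟨u, mem_inter.2 ⟨(mem_insert.1 hu2).resolve_left ?_, hu1⟩⟩
    rintro rfl
    exact hwA hu1
  have hin : ∑ x ∈ A, G.degree x + ∑ x ∈ A, #(G.neighborFinset x ∩ T)
      ≤ #A * b + #{x ∈ A | G.degree x = b + 1} := by
    rw [card_filter, ← smul_eq_mul, ← sum_const, ← sum_add_distrib, ← sum_add_distrib]
    refine sum_le_sum fun x hx => ?_
    have hdeg := hΔ x
    rcases (G.neighborFinset x ∩ T).eq_empty_or_nonempty with he | ⟨w, hw⟩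
    · rw [he, card_empty]
      split_ifs <;> omega
    · obtain ⟨hxw, hwT⟩ := mem_inter.1 hw
      obtain ⟨hwA, hwd⟩ := mem_filter.1 hwT
      rw [mem_compl] at hwA
      have hxv : G.Adj v x := by
        rcases mem_insert.1 hx with rfl | hx
        · exact absurd (mem_insert_of_mem hxw) hwA
        · exact (mem_neighborFinset _ _ _).1 hx
      have h1 := h.two_mul_degree_le hirr hV hΔ hv hxv hwd
        ((mem_neighborFinset _ _ _).1 hxw).symm hwA
      have h2 := h.card_sdiff_le_two hv hxv
      rw [← hA] at h2
      have h3 : #(G.neighborFinset x ∩ T) ≤ #(G.neighborFinset x \ A) := by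
        refine card_le_card fun y hy => ?_
        obtain ⟨hy1, hy2⟩ := mem_inter.1 hy
        exact mem_sdiff.2 ⟨hy1, mem_compl.1 (mem_filter.1 hy2).1⟩
      omega
  rw [← sum_add_sum_compl A, ← card_add_card_compl A]
  nlinarith

end Irreducible

/-- The upper bound for graphs without `S_{3,b}`, by induction on `p`. A reducible graph loses
a block of `b + 4` vertices. An irreducible one has maximum degree at most `b + 1`, which is enough unless
it has fewer than `2 * (b + 4)` vertices. -/
theorem SmallEdgeNeighborhoods.card_edgeFinset_le {b q : ℕ} (hb : 3 < b) (hq : q ≤ b + 3)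
    (p : ℕ) : ∀ {V : Type} [Fintype V] [DecidableEq V] (G : SimpleGraph V) [DecidableRel G.Adj],
    G.SmallEdgeNeighborhoods b → Fintype.card V = p * (b + 4) + q →
      #G.edgeFinset ≤ turanValue b q p := by
  induction p with
  | zero =>
    intro V _ _ G _ _ hV
    have := G.card_edgeFinset_le_card_choose_two
    rwa [hV, zero_mul, zero_add] at this
  | succ p ih =>
    intro V _ _ G _ h hV
    have hK := two_mul_choose_two_add_four b
    have hn : Fintype.card V = p * (b + 4) + (b + 4 + q) := by rw [hV]; ring
    by_cases hred : G.Reducible b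
    · obtain ⟨S, hS, hSm⟩ := hred
      have h1 := G.two_mul_card_edgeFinset_eq_twiceMeeting_add S
      have h2 : #(G.induce {x | x ∉ S}).edgeFinset ≤ turanValue b q p := by
        refine ih _ ?_ ?_
        · rintro ⟨u, hu⟩ ⟨v, hv⟩ huv hdu hdv
          rw [degree_induce_compl] at hdu hdv
          refine le_trans ?_ (h u v (by simpa using huv)
            (hdu.trans (card_sdiff_neighborFinset_le_degree _ _))
            (hdv.trans (card_sdiff_neighborFinset_le_degree _ _)))
          rw [← card_map (Function.Embedding.subtype _)]
          refine card_le_card fun y => ?_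
          simp
          tauto
        · have h3 : Fintype.card {x | x ∉ S} = #Sᶜ := by
            rw [← Set.toFinset_card]; congr 1; ext; simp
          rw [h3, card_compl, hS, hV]
          have : (p + 1) * (b + 4) = p * (b + 4) + (b + 4) := by ring
          omega
      have h3 : (b + 4).choose 2 + turanValue b q p ≤ turanValue b q (p + 1) := by
        rcases p with - | p
        · simpa [turanValue] using choose_add_choose_le_twoBlockNumber hq
        · simp only [turanValue]
          linarith
      omega
    have hV4 : b + 4 ≤ Fintype.card V := by omega
    have hΔ3 : ∀ x, G.degree x ≤ b + 3 := fun x => by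
      by_contra! hx
      exact hred (h.reducible_of_add_four_le hb hx)
    have hΔ2 : ∀ x, G.degree x ≤ b + 2 := fun x => by
      by_contra! hx
      exact hred (h.reducible_of_eq_add_three hb hΔ3 (le_antisymm (hΔ3 x) hx))
    have hΔ : ∀ x, G.degree x ≤ b + 1 := fun x => by
      by_contra! hx
      exact hred (h.reducible_of_eq_add_two hb hV4 hΔ2 (le_antisymm (hΔ2 x) hx))
    have hsum := G.sum_degrees_eq_twice_card_edges
    have hcrude : 2 * #G.edgeFinset ≤ (b + 1) * Fintype.card V := by
      rw [← hsum, mul_comm, ← smul_eq_mul, ← card_univ]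
      exact sum_le_card_nsmul _ _ _ fun x _ => hΔ x
    have hg := mul_le_two_mul_twoBlockNumber hb hq
    rcases Nat.eq_zero_or_pos p with rfl | hp
    · rw [turanValue, zero_mul, zero_add]
      rw [zero_mul, zero_add] at hn
      by_cases hT : ∃ v, G.degree v = b + 1
      · obtain ⟨v, hv⟩ := hT
        refine le_twoBlockNumber
          (s := #{x ∈ insert v (G.neighborFinset v) | G.degree x = b + 1}) hb hq ?_ ?_ ?_ ?_ ?_
        · refine (card_filter_le _ _).trans ?_
          rw [card_insert_neighborFinset, hv]
        · exact card_pos.2 ⟨v, by simp [hv]⟩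
        · rwa [hn] at hcrude
        · have h1 := h.twiceMeeting_add_le hred hV4 hΔ hv
          have h2 := G.two_mul_card_edgeFinset_eq_twiceMeeting_add (insert v (G.neighborFinset v))
          have h3 :=
            (G.induce {x | x ∉ insert v (G.neighborFinset v)}).card_edgeFinset_le_card_choose_two
          have h4 : Fintype.card {x | x ∉ insert v (G.neighborFinset v)} = q + 2 := by
            have h5 : Fintype.card {x | x ∉ insert v (G.neighborFinset v)}
                = #(insert v (G.neighborFinset v))ᶜ := by
              rw [← Set.toFinset_card]; congr 1; ext; simp
            rw [h5, card_compl, card_insert_neighborFinset, hv, hn]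
            omega
          rw [h4] at h3
          have h5 := two_mul_choose_two (q + 2)
          have h6 : (q + 2) * (q + 2 - 1) = (q + 2) * (q + 1) := rfl
          omega
        · intro hqb
          rw [← hsum, ← hn]
          exact h.sum_degrees_le hb hred hV4 (by omega) hΔ hv
      · have : 2 * #G.edgeFinset ≤ b * Fintype.card V := by
          rw [← hsum, mul_comm, ← smul_eq_mul, ← card_univ]
          refine sum_le_card_nsmul _ _ _ fun x _ => ?_
          have h1 := hΔ x
          have h2 : G.degree x ≠ b + 1 := fun h => hT ⟨x, h⟩
          omega
        rw [hn] at this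
        omega
    · rw [turanValue]
      rw [hn] at hcrude
      nlinarith

/-! ### Double stars and neighbourhoods of edges -/

/-- Hall's condition for the leaves of `S_{a,b}`: `a` elements of `A` and `b` elements of `B`, all
distinct. -/
theorem exists_disjoint_subsets_card_eq {V : Type*} [DecidableEq V] {A B : Finset V} {a b : ℕ}
    (hA : a ≤ #A) (hB : b ≤ #B) (hAB : a + b ≤ #(A ∪ B)) :
    ∃ X ⊆ A, ∃ Y ⊆ B, #X = a ∧ #Y = b ∧ Disjoint X Y := by
  by_cases h : a ≤ #(A \ B)
  · obtain ⟨X, hX, hXc⟩ := exists_subset_card_eq h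
    obtain ⟨Y, hY, hYc⟩ := exists_subset_card_eq hB
    refine ⟨X, hX.trans sdiff_subset, Y, hY, hXc, hYc, ?_⟩
    exact disjoint_of_subset_left hX (disjoint_of_subset_right hY sdiff_disjoint)
  · obtain ⟨X, hX1, hX2, hXc⟩ :=
      exists_subsuperset_card_eq (sdiff_subset : A \ B ⊆ A) (by omega : #(A \ B) ≤ a) hA
    have h1 : b ≤ #(B \ X) := by
      have h2 := card_sdiff_add_card B X
      have h3 : #(A ∪ B) ≤ #(B ∪ X) := by
        refine card_le_card fun x hx => ?_
        by_cases hxB : x ∈ B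
        · exact mem_union_left _ hxB
        · exact mem_union_right _ (hX1 (mem_sdiff.2 ⟨(mem_union.1 hx).resolve_right hxB, hxB⟩))
      omega
    obtain ⟨Y, hY, hYc⟩ := exists_subset_card_eq h1
    exact ⟨X, hX2, Y, hY.trans sdiff_subset, hXc, hYc,
      disjoint_of_subset_right hY disjoint_sdiff⟩

theorem isContained_doubleStar {V : Type*} {G : SimpleGraph V} {a b : ℕ} {u v : V}
    {X Y : Finset V} (huv : G.Adj u v) (hX : ∀ x ∈ X, G.Adj u x ∧ x ≠ v)
    (hY : ∀ y ∈ Y, G.Adj v y ∧ y ≠ u) (hXc : #X = a) (hYc : #Y = b) (hXY : Disjoint X Y) :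
    doubleStar a b ⊑ G := by
  let eX := (X.equivFinOfCardEq hXc).symm
  let eY := (Y.equivFinOfCardEq hYc).symm
  let f : DoubleStarVertex a b → V := fun
    | .u => u
    | .v => v
    | .leafU i => eX i
    | .leafV j => eY j
  have hX' (i) : G.Adj u (eX i) ∧ (eX i : V) ≠ v := hX _ (eX i).2
  have hY' (j) : G.Adj v (eY j) ∧ (eY j : V) ≠ u := hY _ (eY j).2
  have hXY' (i j) : (eX i : V) ≠ eY j := fun h =>
    Finset.disjoint_left.1 hXY (eX i).2 (h ▸ (eY j).2)
  have hf : ∀ x y, DoubleStarEdge a b x y → G.Adj (f x) (f y) := by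
    rintro x y (_ | i | j)
    exacts [huv, (hX' i).1, (hY' j).1]
  refine ⟨⟨⟨f, fun {x y} h => ?_⟩, ?_⟩⟩
  · rw [doubleStar, fromRel_adj] at h
    exact h.2.elim (hf x y) fun h => (hf y x h).symm
  · rintro (_ | _ | i | j) (_ | _ | i' | j') h
    · rfl
    · exact absurd h huv.ne
    · exact absurd h (hX' i').1.ne
    · exact absurd h (hY' j').2.symm
    · exact absurd h huv.ne'
    · rfl
    · exact absurd h (hX' i').2.symm
    · exact absurd h (hY' j').1.ne
    · exact absurd h (hX' i).1.ne'
    · exact absurd h (hX' i).2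
    · exact congrArg _ (eX.injective (Subtype.ext h))
    · exact absurd h (hXY' i j')
    · exact absurd h (hY' j).2
    · exact absurd h (hY' j).1.ne'
    · exact absurd h.symm (hXY' i' j)
    · exact congrArg _ (eY.injective (Subtype.ext h))

theorem doubleStar_adj_of_edge {a b : ℕ} {x y : DoubleStarVertex a b} (h : DoubleStarEdge a b x y) :
    (doubleStar a b).Adj x y := by
  rw [doubleStar, fromRel_adj]
  exact ⟨(by rintro rfl; cases h), .inl h⟩

theorem doubleStar_free_iff {V : Type*} [Fintype V] [DecidableEq V] {G : SimpleGraph V}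
    [DecidableRel G.Adj] {b : ℕ} : (doubleStar 3 b).Free G ↔ G.SmallEdgeNeighborhoods b := by
  constructor
  · intro hfree u v huv hu hv
    by_contra! hcon
    refine hfree ?_
    have hvu : v ∈ G.neighborFinset u := (mem_neighborFinset _ _ _).2 huv
    have huv' : u ∈ G.neighborFinset v := (mem_neighborFinset _ _ _).2 huv.symm
    have hA : #((G.neighborFinset u).erase v) = G.degree u - 1 := by
      rw [card_erase_of_mem hvu, card_neighborFinset_eq_degree]
    have hB : #((G.neighborFinset v).erase u) = G.degree v - 1 := by
      rw [card_erase_of_mem huv', card_neighborFinset_eq_degree]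
    have hAB : #(G.neighborFinset u ∪ G.neighborFinset v)
        ≤ #((G.neighborFinset u).erase v ∪ (G.neighborFinset v).erase u) + 2 := by
      refine le_trans (card_le_card (t := insert u (insert v
        ((G.neighborFinset u).erase v ∪ (G.neighborFinset v).erase u))) ?_)
        ((card_insert_le _ _).trans (Nat.succ_le_succ (card_insert_le _ _)))
      intro x hx
      simp only [mem_insert, mem_union, mem_erase] at hx ⊢
      tauto
    obtain ⟨X, hX, Y, hY, hXc, hYc, hXY⟩ := exists_disjoint_subsets_card_eq (a := 3) (b := b)
      (A := (G.neighborFinset u).erase v) (B := (G.neighborFinset v).erase u)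
      (by omega) (by omega) (by omega)
    refine isContained_doubleStar huv (fun x hx => ?_) (fun y hy => ?_) hXc hYc hXY
    · have := hX hx
      simp only [mem_erase, mem_neighborFinset] at this
      exact this.symm
    · have := hY hy
      simp only [mem_erase, mem_neighborFinset] at this
      exact this.symm
  · rintro h ⟨f⟩
    have hadj {x y} (hxy : DoubleStarEdge 3 b x y) : G.Adj (f x) (f y) :=
      f.toHom.map_adj (doubleStar_adj_of_edge hxy)
    have huv := hadj .central
    let iU : Option (Fin 3) ↪ V := ⟨fun i => f (i.elim .v .leafU), f.injective.comp (by
      rintro (_ | i) (_ | j) <;> simp)⟩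
    let iV : Option (Fin b) ↪ V := ⟨fun i => f (i.elim .u .leafV), f.injective.comp (by
      rintro (_ | i) (_ | j) <;> simp)⟩
    have hU : univ.map iU ⊆ G.neighborFinset (f .u) := by
      intro x hx
      obtain ⟨i, -, rfl⟩ := mem_map.1 hx
      rw [mem_neighborFinset]
      cases i with
      | none => exact huv
      | some i => exact hadj (.atU i)
    have hV : univ.map iV ⊆ G.neighborFinset (f .v) := by
      intro x hx
      obtain ⟨i, -, rfl⟩ := mem_map.1 hx
      rw [mem_neighborFinset]
      cases i with
      | none => exact huv.symm
      | some i => exact hadj (.atV i)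
    have hdisj : Disjoint (univ.map iU) (univ.map iV) := by
      rw [Finset.disjoint_left]
      intro x hx hx'
      obtain ⟨i, -, rfl⟩ := mem_map.1 hx
      obtain ⟨j, -, hj⟩ := mem_map.1 hx'
      have := f.injective hj
      cases i <;> cases j <;> simp at this
    have hcU := card_le_card hU
    have hcV := card_le_card hV
    have hc := card_le_card (union_subset_union hU hV)
    rw [card_union_of_disjoint hdisj] at hc
    simp only [card_map, card_univ, Fintype.card_option, Fintype.card_fin,
      card_neighborFinset_eq_degree] at hcU hcV hc
    have := h _ _ huv (by omega) (by omega)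
    omega

/-! ### Disjoint unions and near regular graphs -/

section Sparse

variable {V W : Type*} [Fintype V] [Fintype W]

theorem smallEdgeNeighborhoods_of_degree_le [DecidableEq V] {G : SimpleGraph V} [DecidableRel G.Adj]
    {b : ℕ} (h : ∀ x, G.degree x ≤ b) : G.SmallEdgeNeighborhoods b := fun _ v _ _ hv =>
  absurd (h v) (by omega)

theorem smallEdgeNeighborhoods_of_card_le [DecidableEq V] {G : SimpleGraph V} [DecidableRel G.Adj]
    {b : ℕ} (h : Fintype.card V ≤ b + 4) : G.SmallEdgeNeighborhoods b := fun _ _ _ _ _ =>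
  (card_le_univ _).trans h

theorem disjointCopies_adj {U : Type*} {G : SimpleGraph U} {k : ℕ} {x y : Fin k × U} :
    (disjointCopies k G).Adj x y ↔ x.1 = y.1 ∧ G.Adj x.2 y.2 :=
  Iff.rfl

theorem smallEdgeNeighborhoods_disjointCopies [DecidableEq V] {G : SimpleGraph V} {b : ℕ} (k : ℕ)
    [DecidableRel (disjointCopies k G).Adj] (h : Fintype.card V ≤ b + 4) :
    (disjointCopies k G).SmallEdgeNeighborhoods b := by
  intro u v huv _ _
  refine le_trans (card_le_card (t := {u.1} ×ˢ univ) ?_) (by simpa using h)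
  intro x hx
  simp only [mem_union, mem_neighborFinset] at hx
  simp only [mem_product, mem_singleton, mem_univ, and_true]
  rcases hx with hx | hx
  · exact hx.1.symm
  · exact hx.1.symm.trans huv.1.symm

theorem neighborFinset_sum_inl (G : SimpleGraph V) (H : SimpleGraph W) [DecidableRel G.Adj]
    [DecidableRel (G ⊕g H).Adj] (u : V) :
    (G ⊕g H).neighborFinset (.inl u) = (G.neighborFinset u).map .inl := by
  ext (x | x) <;> simp

theorem neighborFinset_sum_inr (G : SimpleGraph V) (H : SimpleGraph W) [DecidableRel H.Adj]
    [DecidableRel (G ⊕g H).Adj] (u : W) :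
    (G ⊕g H).neighborFinset (.inr u) = (H.neighborFinset u).map .inr := by
  ext (x | x) <;> simp

theorem SmallEdgeNeighborhoods.sum [DecidableEq V] [DecidableEq W] {G : SimpleGraph V}
    {H : SimpleGraph W} [DecidableRel G.Adj] [DecidableRel H.Adj] [DecidableRel (G ⊕g H).Adj]
    {b : ℕ} (hG : G.SmallEdgeNeighborhoods b)
    (hH : H.SmallEdgeNeighborhoods b) : (G ⊕g H).SmallEdgeNeighborhoods b := by
  rintro (u | u) (v | v) huv hu hv
  · rw [← card_neighborFinset_eq_degree, neighborFinset_sum_inl, card_map,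
      card_neighborFinset_eq_degree] at hu hv
    rw [neighborFinset_sum_inl, neighborFinset_sum_inl, ← map_union, card_map]
    exact hG u v (by simpa using huv) hu hv
  · simp at huv
  · simp at huv
  · rw [← card_neighborFinset_eq_degree, neighborFinset_sum_inr, card_map,
      card_neighborFinset_eq_degree] at hu hv
    rw [neighborFinset_sum_inr, neighborFinset_sum_inr, ← map_union, card_map]
    exact hH u v (by simpa using huv) hu hv

theorem card_edgeFinset_disjointSum (G : SimpleGraph V) (H : SimpleGraph W) [DecidableRel G.Adj]
    [DecidableRel H.Adj] [DecidableRel (G ⊕g H).Adj] :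
    #(G ⊕g H).edgeFinset = #G.edgeFinset + #H.edgeFinset := by
  simp only [edgeFinset_card]
  rw [Fintype.card_congr edgeSetSumEquiv, Fintype.card_sum]

theorem card_edgeFinset_disjointCopies_complete (k m : ℕ)
    [DecidableRel (disjointCopies k (completeGraph (Fin m))).Adj] :
    #(disjointCopies k (completeGraph (Fin m))).edgeFinset = k * m.choose 2 := by
  have h1 : ∀ x, (disjointCopies k (completeGraph (Fin m))).degree x = m - 1 := by
    intro x
    have : (disjointCopies k (completeGraph (Fin m))).neighborFinset x
        = {x.1} ×ˢ univ.erase x.2 := by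
      ext y
      rw [mem_neighborFinset, disjointCopies_adj]
      simp [Prod.ext_iff]
      tauto
    rw [← card_neighborFinset_eq_degree, this]
    simp
  have h2 := sum_degrees_eq_twice_card_edges (disjointCopies k (completeGraph (Fin m)))
  have h3 := two_mul_choose_two m
  simp only [h1, sum_const, card_univ, Fintype.card_prod, Fintype.card_fin, smul_eq_mul] at h2
  rw [mul_assoc, ← h3] at h2
  linarith

end Sparse

section NearRegular

/-- As `2 * h < m`, the jumps `1, …, h` and their negatives are pairwise different. -/
theorem circulant_neighbor_card {m h : ℕ} [NeZero m] (hm : 2 * h < m) (x : Fin m) :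
    #{y : Fin m | (circulantGraph {d : Fin m | 1 ≤ d.val ∧ d.val ≤ h}).Adj x y} = 2 * h := by
  have hc : #{d : Fin m | 1 ≤ d.val ∧ d.val ≤ h} = h := by
    rw [← card_map Fin.valEmbedding]
    have : ({d : Fin m | 1 ≤ d.val ∧ d.val ≤ h} : Finset (Fin m)).map Fin.valEmbedding
        = Finset.Icc 1 h := by
      ext a
      simp only [mem_map, mem_filter, mem_univ, true_and, Fin.valEmbedding_apply, Finset.mem_Icc]
      exact ⟨by rintro ⟨d, hd, rfl⟩; exact hd, fun ha => ⟨⟨a, by omega⟩, ha, rfl⟩⟩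
    rw [this, Nat.card_Icc]
    rfl
  have e1 : #{y : Fin m | 1 ≤ (x - y).val ∧ (x - y).val ≤ h} = h := by
    conv_rhs => rw [← hc]
    exact card_equiv (Equiv.subLeft x) (by simp)
  have e2 : #{y : Fin m | 1 ≤ (y - x).val ∧ (y - x).val ≤ h} = h := by
    conv_rhs => rw [← hc]
    exact card_equiv (Equiv.subRight x) (by simp)
  have hset : ({y : Fin m | (circulantGraph {d : Fin m | 1 ≤ d.val ∧ d.val ≤ h}).Adj x y} :
      Finset (Fin m)) = ({y : Fin m | 1 ≤ (x - y).val ∧ (x - y).val ≤ h} : Finset (Fin m)) ∪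
        ({y : Fin m | 1 ≤ (y - x).val ∧ (y - x).val ≤ h} : Finset (Fin m)) := by
    ext y
    simp only [circulantGraph_adj, mem_filter, mem_univ, true_and, mem_union, Set.mem_ofPred_eq]
    refine ⟨fun h => h.2, fun h => ⟨?_, h⟩⟩
    rintro rfl
    simp at h
  rw [hset, card_union_of_disjoint, e1, e2, two_mul]
  rw [Finset.disjoint_left]
  intro y hy hy'
  simp only [mem_filter, mem_univ, true_and, Fin.val_sub] at hy hy'
  have hx := x.isLt
  have hy2 := y.isLt
  rcases le_total x.val y.val with hxy | hxy
  · have : m - y.val + x.val = m - (y.val - x.val) := by omega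
    have : m - x.val + y.val = m + (y.val - x.val) := by omega
    rcases Nat.eq_or_lt_of_le hxy with h' | h'
    · rw [h', Nat.sub_add_cancel hy2.le, Nat.mod_self] at hy; omega
    · rw [Nat.mod_eq_of_lt (by omega : m - y.val + x.val < m)] at hy
      rw [this, Nat.add_mod_left, Nat.mod_eq_of_lt (by omega)] at hy'
      omega
  · have : m - y.val + x.val = m + (x.val - y.val) := by omega
    rcases Nat.eq_or_lt_of_le hxy with h' | h'
    · rw [h', Nat.sub_add_cancel hx.le, Nat.mod_self] at hy; omega
    · rw [Nat.mod_eq_of_lt (by omega : m - x.val + y.val < m)] at hy'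
      rw [this, Nat.add_mod_left, Nat.mod_eq_of_lt (by omega)] at hy
      omega

/-- The matching `{i, i + ⌊m/2⌋}`, `i < ⌊m/2⌋`; it misses only the vertex `m - 1`, and this only for
odd `m`. -/
def halfMatching (m : ℕ) : SimpleGraph (Fin m) where
  Adj x y := (x.val < m / 2 ∧ y.val = x.val + m / 2) ∨ (y.val < m / 2 ∧ x.val = y.val + m / 2)
  symm := ⟨fun _ _ h => h.symm⟩
  loopless := ⟨fun x h => by omega⟩

theorem halfMatching_adj {m : ℕ} {x y : Fin m} : (halfMatching m).Adj x y ↔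
    (x.val < m / 2 ∧ y.val = x.val + m / 2) ∨ (y.val < m / 2 ∧ x.val = y.val + m / 2) :=
  Iff.rfl

theorem halfMatching_neighbor_card {m : ℕ} [DecidableRel (halfMatching m).Adj] (x : Fin m) :
    #{y : Fin m | (halfMatching m).Adj x y} = if Odd m ∧ x.val + 1 = m then 0 else 1 := by
  have hx := x.isLt
  simp only [Nat.odd_iff]
  split_ifs with h
  · rw [card_eq_zero, filter_eq_empty_iff]
    intro y _
    have hy := y.isLt
    rw [halfMatching_adj]
    omega
  · rw [card_eq_one]
    by_cases h1 : x.val < m / 2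
    · refine ⟨⟨x.val + m / 2, by omega⟩, ?_⟩
      ext y
      simp only [halfMatching_adj, mem_filter, mem_univ, true_and, mem_singleton, Fin.ext_iff]
      omega
    · refine ⟨⟨x.val - m / 2, by omega⟩, ?_⟩
      ext y
      simp only [halfMatching_adj, mem_filter, mem_univ, true_and, mem_singleton, Fin.ext_iff]
      omega

/-- Near `k`-regular graphs exist: a circulant graph, and for odd `k` also a matching of its
longest diagonals. If not all degrees are `k`, the exceptional vertex is the last one. -/
theorem exists_near_regular {k m : ℕ} (hkm : k < m) :
    ∃ (H : SimpleGraph (Fin m)) (_ : DecidableRel H.Adj), ∀ x,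
      H.degree x = if Odd (k * m) ∧ x.val + 1 = m then k - 1 else k := by
  classical
  have : NeZero m := ⟨by omega⟩
  rcases Nat.even_or_odd' k with ⟨h, rfl | rfl⟩
  · refine ⟨circulantGraph {d : Fin m | 1 ≤ d.val ∧ d.val ≤ h}, inferInstance, fun x => ?_⟩
    rw [if_neg (by rw [Nat.odd_mul, Nat.odd_iff]; omega), ← circulant_neighbor_card hkm x,
      ← card_neighborFinset_eq_degree, neighborFinset_eq_filter]
  · refine ⟨circulantGraph {d : Fin m | 1 ≤ d.val ∧ d.val ≤ h} ⊔ halfMatching m, inferInstance,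
      fun x => ?_⟩
    have hdisj : Disjoint
        ({y | (circulantGraph {d : Fin m | 1 ≤ d.val ∧ d.val ≤ h}).Adj x y} : Finset (Fin m))
        ({y | (halfMatching m).Adj x y} : Finset (Fin m)) := by
      rw [Finset.disjoint_left]
      intro y hy hy'
      simp only [mem_filter, mem_univ, true_and, circulantGraph_adj, Set.mem_ofPred_eq,
        Fin.val_sub] at hy
      simp only [mem_filter, mem_univ, true_and, halfMatching_adj] at hy'
      have hx := x.isLt
      have hy2 := y.isLt
      rcases hy' with ⟨h1, h2⟩ | ⟨h1, h2⟩
      · have e1 : m - y.val + x.val = m - m / 2 := by omega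
        have e2 : m - x.val + y.val = m + m / 2 := by omega
        rw [e1, e2, Nat.add_mod_left, Nat.mod_eq_of_lt (by omega : m - m / 2 < m),
          Nat.mod_eq_of_lt (by omega : m / 2 < m)] at hy
        omega
      · have e1 : m - x.val + y.val = m - m / 2 := by omega
        have e2 : m - y.val + x.val = m + m / 2 := by omega
        rw [e1, e2, Nat.add_mod_left, Nat.mod_eq_of_lt (by omega : m - m / 2 < m),
          Nat.mod_eq_of_lt (by omega : m / 2 < m)] at hy
        omega
    rw [← card_neighborFinset_eq_degree, neighborFinset_eq_filter]
    simp only [sup_adj]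
    rw [filter_or, card_union_of_disjoint hdisj, circulant_neighbor_card (by omega) x,
      halfMatching_neighbor_card]
    have hodd : Odd ((2 * h + 1) * m) ↔ Odd m := by
      rw [Nat.odd_mul, and_iff_right ⟨h, rfl⟩]
    simp only [hodd]
    split_ifs <;> rfl

end NearRegular

/-! ### The exceptional extremal graphs -/

section Chain

variable {S R K : Type*}

/-- A clique on `S` completely joined to the graph `H` on `R`, which is joined by the bipartite
graph `B` to a clique on `K`; there are no edges between `S` and `K`. -/
def cliqueChain (S : Type*) (H : SimpleGraph R) (B : R → K → Prop) : SimpleGraph (S ⊕ R ⊕ K) where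
  Adj
    | .inl a, .inl a' => a ≠ a'
    | .inl _, .inr (.inl _) => True
    | .inr (.inl _), .inl _ => True
    | .inr (.inl i), .inr (.inl i') => H.Adj i i'
    | .inr (.inl i), .inr (.inr j) => B i j
    | .inr (.inr j), .inr (.inl i) => B i j
    | .inr (.inr j), .inr (.inr j') => j ≠ j'
    | .inl _, .inr (.inr _) => False
    | .inr (.inr _), .inl _ => False
  symm := ⟨by
    rintro (a | i | j) (a' | i' | j') h
    exacts [Ne.symm h, h, h, h, H.adj_symm h, h, h, h, Ne.symm h]⟩
  loopless := ⟨by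
    rintro (a | i | j) h
    exacts [h rfl, H.irrefl h, h rfl]⟩

variable [Fintype S] [Fintype R] [Fintype K] {H : SimpleGraph R} {B : R → K → Prop}
  [DecidableRel (cliqueChain S H B).Adj]

theorem neighborFinset_cliqueChain_inl [DecidableEq S] (a : S) :
    (cliqueChain S H B).neighborFinset (.inl a)
      = (univ.erase a).disjSum ((univ : Finset R).disjSum ∅) := by
  ext (a' | i | j) <;> rw [mem_neighborFinset] <;> simp [cliqueChain, eq_comm]

theorem neighborFinset_cliqueChain_inr_inl [DecidableRel H.Adj] [∀ i, DecidablePred (B i)] (i : R) :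
    (cliqueChain S H B).neighborFinset (.inr (.inl i))
      = (univ : Finset S).disjSum ((H.neighborFinset i).disjSum {j | B i j}) := by
  ext (a' | i | j) <;> rw [mem_neighborFinset] <;> simp [cliqueChain]

theorem neighborFinset_cliqueChain_inr_inr [DecidableEq K] [∀ i, DecidablePred (B i)] (j : K) :
    (cliqueChain S H B).neighborFinset (.inr (.inr j))
      = (∅ : Finset S).disjSum (({i | B i j} : Finset R).disjSum (univ.erase j)) := by
  ext (a' | i | j) <;> rw [mem_neighborFinset] <;> simp [cliqueChain, eq_comm]

theorem degree_cliqueChain_inl (a : S) :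
    (cliqueChain S H B).degree (.inl a) = Fintype.card S - 1 + Fintype.card R := by
  classical
  rw [← card_neighborFinset_eq_degree, neighborFinset_cliqueChain_inl]
  simp [card_disjSum]

theorem degree_cliqueChain_inr_inl [DecidableRel H.Adj] [∀ i, DecidablePred (B i)] (i : R) :
    (cliqueChain S H B).degree (.inr (.inl i)) = Fintype.card S + (H.degree i + #{j | B i j}) := by
  rw [← card_neighborFinset_eq_degree, neighborFinset_cliqueChain_inr_inl]
  simp [card_disjSum]

theorem degree_cliqueChain_inr_inr [∀ i, DecidablePred (B i)] (j : K) :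
    (cliqueChain S H B).degree (.inr (.inr j)) = #{i | B i j} + (Fintype.card K - 1) := by
  classical
  rw [← card_neighborFinset_eq_degree, neighborFinset_cliqueChain_inr_inr]
  simp [card_disjSum]

theorem smallEdgeNeighborhoods_cliqueChain [DecidableEq S] [DecidableEq R] [DecidableEq K]
    [DecidableRel H.Adj] [∀ i, DecidablePred (B i)] {b : ℕ}
    (hSR : Fintype.card S + Fintype.card R = b + 2)
    (hB : ∀ i, #{j | B i j} ≤ 2)
    (hR : ∀ i, Fintype.card S + (H.degree i + #{j | B i j}) ≤ b)
    (hK : ∀ j, #{i | B i j} + (Fintype.card K - 1) ≤ b) :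
    (cliqueChain S H B).SmallEdgeNeighborhoods b := by
  intro u v huv _ hv
  rcases v with a | i | j
  · rcases u with a' | i | j
    · refine le_trans (card_le_card (t := univ.disjSum (univ.disjSum ∅)) ?_)
        (by rw [card_disjSum, card_disjSum, card_univ, card_univ, card_empty]; omega)
      rw [neighborFinset_cliqueChain_inl, neighborFinset_cliqueChain_inl]
      rintro (a | i | j) <;> simp
    · refine le_trans (card_le_card (t := univ.disjSum (univ.disjSum {j | B i j})) ?_) ?_
      · rw [neighborFinset_cliqueChain_inl, neighborFinset_cliqueChain_inr_inl]
        rintro (a | i | j) <;> simp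
      · rw [card_disjSum, card_disjSum, card_univ, card_univ]
        have := hB i
        omega
    · exact huv.elim
  · rw [degree_cliqueChain_inr_inl] at hv
    have := hR i
    omega
  · rw [degree_cliqueChain_inr_inr] at hv
    have := hK j
    omega

end Chain

/-- The graphs `cliqueChain` in which all degrees outside of the first clique are `b`, but for one
vertex that may have degree `b - 1`. -/
theorem exists_of_cliqueChain {b s r k m : ℕ} (hs : 1 ≤ s) (hsr : s + r = b + 2)
    (hm : s + r + k = m) (H : SimpleGraph (Fin r)) [DecidableRel H.Adj] (B : Fin r → Fin k → Prop)
    [∀ i, DecidablePred (B i)] (i₀ : Fin r) (hB : ∀ i, #{j | B i j} ≤ 2)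
    (hR : ∀ i ≠ i₀, s + (H.degree i + #{j | B i j}) = b)
    (hR₀ : s + (H.degree i₀ + #{j | B i₀ j}) ≤ b)
    (hR₁ : b ≤ s + (H.degree i₀ + #{j | B i₀ j}) + 1)
    (hK : ∀ j, #{i | B i j} + (k - 1) = b) :
    ∃ (L : SimpleGraph (Fin m)) (_ : DecidableRel L.Adj), L.maxDegree = b + 1 ∧
      L.SmallEdgeNeighborhoods b ∧ (b * m + s) / 2 ≤ #L.edgeFinset := by
  classical
  let C := cliqueChain (Fin s) H B
  let e : Fin s ⊕ Fin r ⊕ Fin k ≃ Fin m := Fintype.equivFinOfCardEq (by simp; omega)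
  let L : SimpleGraph (Fin m) := C.map e.toEmbedding
  let φ : C ≃g L := Iso.map e C
  have hR' : ∀ i, s + (H.degree i + #{j | B i j}) ≤ b := fun i => by
    by_cases hi : i = i₀
    · rw [hi]; exact hR₀
    · exact (hR i hi).le
  have hC : C.SmallEdgeNeighborhoods b := by
    refine smallEdgeNeighborhoods_cliqueChain ?_ hB ?_ ?_
    · simpa using hsr
    · simpa using hR'
    · simpa using fun j => (hK j).le
  have hL : L.SmallEdgeNeighborhoods b := by
    rw [← doubleStar_free_iff] at hC ⊢
    rwa [← free_congr_right φ]
  refine ⟨L, inferInstance, ?_, hL, ?_⟩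
  · rw [← φ.maxDegree_eq]
    refine le_antisymm (maxDegree_le_of_forall_degree_le _ _ ?_) ?_
    · rintro (a | i | j)
      · rw [degree_cliqueChain_inl, Fintype.card_fin, Fintype.card_fin]; omega
      · rw [degree_cliqueChain_inr_inl, Fintype.card_fin]
        exact (hR' i).trans (Nat.le_succ b)
      · rw [degree_cliqueChain_inr_inr, Fintype.card_fin, hK j]; omega
    · refine le_trans ?_ (C.degree_le_maxDegree (.inl ⟨0, hs⟩))
      rw [degree_cliqueChain_inl, Fintype.card_fin, Fintype.card_fin]; omega
  · rw [← φ.card_edgeFinset_eq]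
    have h1 := C.sum_degrees_eq_twice_card_edges
    rw [Fintype.sum_sum_type, Fintype.sum_sum_type] at h1
    have h2 : ∑ a, C.degree (.inl a) = s * (b + 1) := by
      rw [sum_congr rfl fun a _ => (degree_cliqueChain_inl a : C.degree _ = _)]
      simp only [Fintype.card_fin, sum_const, card_univ, smul_eq_mul]
      congr 1
      omega
    have h3 : r * b ≤ ∑ i, C.degree (.inr (.inl i)) + 1 := by
      have : ∑ i : Fin r, (if i = i₀ then 1 else 0) = 1 := by simp
      rw [← this, ← sum_add_distrib]
      have h4 : ∑ _i : Fin r, b = r * b := by simp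
      rw [← h4]
      refine sum_le_sum fun i _ => ?_
      rw [degree_cliqueChain_inr_inl, Fintype.card_fin]
      split_ifs with hi
      · rw [hi]; exact hR₁
      · exact (hR i hi).ge
    have h4 : ∑ j, C.degree (.inr (.inr j)) = k * b := by
      rw [sum_congr rfl fun j _ => (degree_cliqueChain_inr_inr j : C.degree _ = _)]
      simp only [Fintype.card_fin, hK, sum_const, card_univ, smul_eq_mul]
    have h5 : b * m + s = s * (b + 1) + r * b + k * b := by rw [← hm]; ring
    omega

/-- For `q = b - 3`: a triangle, a near `(b - 5)`-regular graph on `b - 1` vertices, and a clique of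
size `b - 1` which is joined to it by a cycle of length `2 * (b - 1)`. -/
theorem exists_extremal_of_sub_three {b : ℕ} (hb : 22 ≤ b) :
    ∃ (L : SimpleGraph (Fin (2 * b + 1))) (_ : DecidableRel L.Adj), L.maxDegree = b + 1 ∧
      L.SmallEdgeNeighborhoods b ∧ (b * (2 * b + 1) + 3) / 2 ≤ #L.edgeFinset := by
  obtain ⟨H, _, hH⟩ := exists_near_regular (k := b - 5) (m := b - 1) (by omega)
  have : NeZero (b - 1) := ⟨by omega⟩
  have : Nontrivial (Fin (b - 1)) := Fin.nontrivial_iff_two_le.2 (by omega)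
  have h01 : (1 : Fin (b - 1)) ≠ 0 := by
    intro h
    have := congrArg Fin.val h
    rw [Fin.val_one', Nat.mod_eq_of_lt (by omega)] at this
    simp at this
  have h1 : ∀ i : Fin (b - 1), #{j | j = i ∨ j = i + 1} = 2 := fun i => by
    rw [card_eq_two]
    exact ⟨i, i + 1, by simpa using h01, by ext; simp⟩
  have h2 : ∀ j : Fin (b - 1), #{i | j = i ∨ j = i + 1} = 2 := fun j => by
    rw [card_eq_two]
    exact ⟨j, j - 1, fun h => h01 (sub_eq_self.1 h.symm), by ext; simp [eq_sub_iff_add_eq, eq_comm]⟩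
  refine exists_of_cliqueChain (s := 3) (r := b - 1) (k := b - 1) (by omega) (by omega) (by omega) H
    (fun i j => j = i ∨ j = i + 1) ⟨b - 2, by omega⟩ (fun i => (h1 i).le) ?_ ?_ ?_ ?_
  · intro i hi
    rw [h1, hH, if_neg]
    · omega
    · rintro ⟨-, h⟩
      exact hi (Fin.ext (by simp only; omega))
  · rw [h1, hH]
    split_ifs <;> omega
  · rw [h1, hH]
    split_ifs <;> omega
  · intro j
    rw [h2]
    omega

/-- For `q = b - 2`: a clique of size `2 + ⌊b/2⌋`, a graph on `⌈b/2⌉` vertices in which almost all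
vertices have exactly three non-neighbours, and a clique of size `b` whose vertices have one
neighbour each in this graph, at most two of them the same one. -/
theorem exists_extremal_of_sub_two {b : ℕ} (hb : 34 ≤ b) :
    ∃ (L : SimpleGraph (Fin (2 * b + 2))) (_ : DecidableRel L.Adj), L.maxDegree = b + 1 ∧
      L.SmallEdgeNeighborhoods b ∧ (b * (2 * b + 2) + 2 + b / 2) / 2 ≤ #L.edgeFinset := by
  classical
  -- The last vertex of `H` has one neighbour in the second clique if `b` is odd, and two if `b` is
  -- even. Depending on this, its degree in `H` is allowed to deviate upwards or downwards.
  obtain ⟨H, _, hH, hH'⟩ : ∃ (H : SimpleGraph (Fin (b - b / 2))) (_ : DecidableRel H.Adj),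
      (∀ i : Fin (b - b / 2), i.val + 1 ≠ b - b / 2 → H.degree i + 4 = b - b / 2) ∧
      ∀ i : Fin (b - b / 2), i.val + 1 = b - b / 2 → H.degree i + 4 ≤ b - b / 2 + b % 2 ∧
        b - b / 2 + b % 2 ≤ H.degree i + 5 := by
    rcases Nat.mod_two_eq_zero_or_one b with hpar | hpar
    · obtain ⟨H, _, hH⟩ := exists_near_regular (k := b - b / 2 - 4) (m := b - b / 2) (by omega)
      refine ⟨H, inferInstance, fun i hi => ?_, fun i hi => ?_⟩
      · rw [hH, if_neg (fun h => hi h.2)]; omega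
      · rw [hH]; split_ifs <;> omega
    · obtain ⟨H, _, hH⟩ := exists_near_regular (k := 3) (m := b - b / 2) (by omega)
      refine ⟨Hᶜ, inferInstance, fun i hi => ?_, fun i hi => ?_⟩
      · rw [degree_compl, Fintype.card_fin, hH, if_neg (fun h => hi h.2)]; omega
      · rw [degree_compl, Fintype.card_fin, hH]; split_ifs <;> omega
  have h1 : ∀ i : Fin (b - b / 2), i.val + 1 ≠ b - b / 2 →
      #{j : Fin b | j.val / 2 = i.val} = 2 := fun i hi => by
    have := i.isLt
    rw [card_eq_two]
    refine ⟨⟨2 * i.val, by omega⟩, ⟨2 * i.val + 1, by omega⟩, by simp, ?_⟩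
    ext j
    simp only [mem_filter, mem_univ, true_and, mem_insert, mem_singleton, Fin.ext_iff]
    omega
  have h1' : ∀ i : Fin (b - b / 2), i.val + 1 = b - b / 2 →
      #{j : Fin b | j.val / 2 = i.val} + b % 2 = 2 := fun i hi => by
    rcases Nat.mod_two_eq_zero_or_one b with hpar | hpar
    · rw [hpar, add_zero, card_eq_two]
      refine ⟨⟨2 * i.val, by omega⟩, ⟨2 * i.val + 1, by omega⟩, by simp, ?_⟩
      ext j
      simp only [mem_filter, mem_univ, true_and, mem_insert, mem_singleton, Fin.ext_iff]
      omega
    · suffices #{j : Fin b | j.val / 2 = i.val} = 1 by omega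
      rw [card_eq_one]
      refine ⟨⟨2 * i.val, by omega⟩, ?_⟩
      ext j
      have := j.isLt
      simp only [mem_filter, mem_univ, true_and, mem_singleton, Fin.ext_iff]
      omega
  have h2 : ∀ j : Fin b, #{i : Fin (b - b / 2) | j.val / 2 = i.val} = 1 := fun j => by
    have := j.isLt
    rw [card_eq_one]
    refine ⟨⟨j.val / 2, by omega⟩, ?_⟩
    ext i
    simp only [mem_filter, mem_univ, true_and, mem_singleton, Fin.ext_iff]
    omega
  rw [add_assoc]
  have hlast : b - b / 2 - 1 + 1 = b - b / 2 := by omega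
  refine exists_of_cliqueChain (s := 2 + b / 2) (r := b - b / 2) (k := b) (by omega) (by omega)
    (by omega) H (fun i j => j.val / 2 = i.val) ⟨b - b / 2 - 1, by omega⟩ ?_ ?_ ?_ ?_ ?_
  · intro i
    by_cases hi : i.val + 1 = b - b / 2
    · have := h1' i hi
      omega
    · exact (h1 i hi).le
  · intro i hi
    have hi' : i.val + 1 ≠ b - b / 2 := fun h => hi (Fin.ext (by simp only; omega))
    rw [h1 i hi']
    have := hH i hi'
    omega
  · have e1 := h1' ⟨b - b / 2 - 1, by omega⟩ hlast
    have e2 := hH' ⟨b - b / 2 - 1, by omega⟩ hlast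
    omega
  · have e1 := h1' ⟨b - b / 2 - 1, by omega⟩ hlast
    have e2 := hH' ⟨b - b / 2 - 1, by omega⟩ hlast
    omega
  · intro j
    rw [h2]
    omega

end SimpleGraph

/-! ### The Turán numbers -/

open Finset in
/-- A graph without `S_{3,b}` that attains the upper bound determines the Turán number. -/
theorem IsExtremalGraph.of_turanValue_le {b q p n : ℕ} (hb : 3 < b) (hq : q ≤ b + 3)
    (hn : n = p * (b + 4) + q) {V : Type} [Fintype V] [DecidableEq V] {G : SimpleGraph V}
    [DecidableRel G.Adj] (hV : Fintype.card V = n) (hG : G.SmallEdgeNeighborhoods b)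
    (he : turanValue b q p ≤ #G.edgeFinset) :
    SimpleGraph.extremalNumber n (doubleStar 3 b) = turanValue b q p ∧
      IsExtremalGraph n (doubleStar 3 b) G := by
  have hfree := SimpleGraph.doubleStar_free_iff.2 hG
  have h1 := SimpleGraph.card_edgeFinset_le_extremalNumber hfree
  rw [hV] at h1
  have h2 : SimpleGraph.extremalNumber n (doubleStar 3 b) ≤ turanValue b q p := by
    rw [← Fintype.card_fin n, SimpleGraph.extremalNumber_le_iff]
    intro L _ hL
    exact (SimpleGraph.doubleStar_free_iff.1 hL).card_edgeFinset_le hb hq p L (by simpa using hn)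
  refine ⟨by omega, hV, hfree, ?_⟩
  rw [← SimpleGraph.coe_edgeFinset, Set.ncard_coe_finset]
  omega

open Finset in
theorem isExtremalGraph_disjointCopies_sum {b q p n m : ℕ} (hb : 3 < b) (hq : q ≤ b + 3)
    (hp : 1 ≤ p) (hn : n = p * (b + 4) + q) (hm : m = b + 4 + q) {L : SimpleGraph (Fin m)}
    [DecidableRel L.Adj] (hL : L.SmallEdgeNeighborhoods b)
    (he : twoBlockNumber b q ≤ #L.edgeFinset) :
    SimpleGraph.extremalNumber n (doubleStar 3 b)
        = (p - 1) * (b + 4).choose 2 + twoBlockNumber b q ∧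
      IsExtremalGraph n (doubleStar 3 b)
        (disjointCopies (p - 1) (SimpleGraph.completeGraph (Fin (b + 4))) ⊕g L) := by
  classical
  obtain ⟨p, rfl⟩ := Nat.exists_eq_add_of_le' hp
  simp only [Nat.add_sub_cancel]
  refine IsExtremalGraph.of_turanValue_le (p := p + 1) hb hq hn ?_
    ((SimpleGraph.smallEdgeNeighborhoods_disjointCopies _ (by simp)).sum hL) ?_
  · simp [hn, hm]
    ring
  · rw [SimpleGraph.card_edgeFinset_disjointSum,
      SimpleGraph.card_edgeFinset_disjointCopies_complete, turanValue]
    exact Nat.add_le_add_left he _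

open Finset in
theorem IsNearRegular.smallEdgeNeighborhoods {V : Type*} [Fintype V] [DecidableEq V]
    {L : SimpleGraph V} [DecidableRel L.Adj] {b : ℕ} (hL : IsNearRegular L b) :
    L.SmallEdgeNeighborhoods b := by
  refine SimpleGraph.smallEdgeNeighborhoods_of_degree_le fun w => ?_
  by_cases h : Even (b * Fintype.card V)
  · exact (hL.1 h w).le
  · obtain ⟨x, hx, hw⟩ := hL.2 h
    by_cases hwx : w = x
    · rw [hwx, hx]; exact Nat.sub_le _ _
    · exact (hw w hwx).le

open Finset in
theorem IsNearRegular.le_card_edgeFinset {V : Type*} [Fintype V]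
    {L : SimpleGraph V} [DecidableRel L.Adj] {b : ℕ} (hL : IsNearRegular L b) :
    b * Fintype.card V / 2 ≤ #L.edgeFinset := by
  classical
  have h1 := L.sum_degrees_eq_twice_card_edges
  by_cases h : Even (b * Fintype.card V)
  · rw [sum_congr rfl fun x _ => hL.1 h x, sum_const, card_univ, smul_eq_mul, mul_comm] at h1
    omega
  · obtain ⟨x, hx, hw⟩ := hL.2 h
    have h2 : ∑ _w : V, b ≤ ∑ w, L.degree w + ∑ w, (if w = x then 1 else 0) := by
      rw [← sum_add_distrib]
      refine sum_le_sum fun w _ => ?_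
      split_ifs with hwx
      · rw [hwx]; omega
      · exact (hw w hwx).ge
    rw [sum_ite_eq' univ x, if_pos (mem_univ x), sum_const, card_univ, smul_eq_mul, mul_comm] at h2
    omega

theorem exists_isNearRegular {b m : ℕ} (hbm : b < m) :
    ∃ (L : SimpleGraph (Fin m)) (_ : DecidableRel L.Adj), IsNearRegular L b := by
  obtain ⟨L, _, hL⟩ := SimpleGraph.exists_near_regular hbm
  refine ⟨L, inferInstance, fun h w => ?_, fun h => ⟨⟨m - 1, by omega⟩, ?_, fun w hw => ?_⟩⟩
  · rw [Fintype.card_fin] at h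
    rw [hL, if_neg fun h' => Nat.not_even_iff_odd.2 h'.1 h]
  · rw [Fintype.card_fin, Nat.not_even_iff_odd] at h
    rw [hL, if_pos ⟨h, by simp only; omega⟩]
  · rw [hL, if_neg fun h' => hw (Fin.ext (by simp only; omega))]

open SimpleGraph in
theorem theorem1p4 (n b p q : ℕ) (hb : 3 < b) (hn : b + 5 ≤ n) (hq : q ≤ b + 3)
    (hnpq : n = p * (b + 4) + q) :
    (NearRegularRange b q →
      extremalNumber n (doubleStar 3 b) =
          (p - 1) * (b + 4).choose 2 + b * (b + 4 + q) / 2 ∧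
        (∃ (L : SimpleGraph (Fin (b + 4 + q))) (_ : DecidableRel L.Adj), IsNearRegular L b) ∧
        (∀ (L : SimpleGraph (Fin (b + 4 + q))) [DecidableRel L.Adj], IsNearRegular L b →
          IsExtremalGraph n (doubleStar 3 b)
            (disjointCopies (p - 1) (completeGraph (Fin (b + 4))) ⊕g L))) ∧
    (22 ≤ b ∧ q = b - 3 →
      extremalNumber n (doubleStar 3 b) =
          (p - 1) * (b + 4).choose 2 + (b * (2 * b + 1) + 3) / 2 ∧
        ∃ (L : SimpleGraph (Fin (2 * b + 1))) (_ : DecidableRel L.Adj), L.maxDegree = b + 1 ∧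
          IsExtremalGraph n (doubleStar 3 b)
            (disjointCopies (p - 1) (completeGraph (Fin (b + 4))) ⊕g L)) ∧
    (34 ≤ b ∧ q = b - 2 →
      extremalNumber n (doubleStar 3 b) =
          (p - 1) * (b + 4).choose 2 + (b * (2 * b + 2) + 2 + b / 2) / 2 ∧
        ∃ (L : SimpleGraph (Fin (2 * b + 2))) (_ : DecidableRel L.Adj), L.maxDegree = b + 1 ∧
          IsExtremalGraph n (doubleStar 3 b)
            (disjointCopies (p - 1) (completeGraph (Fin (b + 4))) ⊕g L)) ∧
    (¬ NearRegularRange b q ∧ ¬ (22 ≤ b ∧ q = b - 3) ∧ ¬ (34 ≤ b ∧ q = b - 2) →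
      extremalNumber n (doubleStar 3 b) = p * (b + 4).choose 2 + q.choose 2 ∧
        IsExtremalGraph n (doubleStar 3 b)
          (disjointCopies p (completeGraph (Fin (b + 4))) ⊕g completeGraph (Fin q))) := by
  classical
  have hp : 1 ≤ p := by
    by_contra! h
    rw [Nat.lt_one_iff.1 h, zero_mul] at hnpq
    omega
  refine ⟨fun h => ?_, fun h => ?_, fun h => ?_, fun h => ?_⟩
  · have hval : twoBlockNumber b q = b * (b + 4 + q) / 2 := by rw [twoBlockNumber, if_pos h]
    have key (L : SimpleGraph (Fin (b + 4 + q))) [DecidableRel L.Adj] (hL : IsNearRegular L b) :=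
      isExtremalGraph_disjointCopies_sum hb hq hp hnpq rfl hL.smallEdgeNeighborhoods
        (by simpa [hval] using hL.le_card_edgeFinset)
    obtain ⟨L, _, hL⟩ := exists_isNearRegular (b := b) (m := b + 4 + q) (by omega)
    refine ⟨?_, ⟨L, inferInstance, hL⟩, fun L _ hL => (key L hL).2⟩
    rw [(key L hL).1, hval]
  · have hval : twoBlockNumber b q = (b * (2 * b + 1) + 3) / 2 := by
      rw [twoBlockNumber, if_neg, if_pos h]
      unfold NearRegularRange
      omega
    obtain ⟨L, _, hΔ, hL, he⟩ := exists_extremal_of_sub_three h.1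
    have key := isExtremalGraph_disjointCopies_sum hb hq hp hnpq (by omega) hL (hval.trans_le he)
    exact ⟨by rw [key.1, hval], L, inferInstance, hΔ, key.2⟩
  · have hval : twoBlockNumber b q = (b * (2 * b + 2) + 2 + b / 2) / 2 := by
      rw [twoBlockNumber, if_neg, if_neg (by omega), if_pos h]
      unfold NearRegularRange
      omega
    obtain ⟨L, _, hΔ, hL, he⟩ := exists_extremal_of_sub_two h.1
    have key := isExtremalGraph_disjointCopies_sum hb hq hp hnpq (by omega) hL (hval.trans_le he)
    exact ⟨by rw [key.1, hval], L, inferInstance, hΔ, key.2⟩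
  · have hval : turanValue b q p = p * (b + 4).choose 2 + q.choose 2 := by
      obtain ⟨p, rfl⟩ := Nat.exists_eq_add_of_le' hp
      rw [turanValue, twoBlockNumber, if_neg h.1, if_neg h.2.1, if_neg h.2.2]
      ring
    rw [← hval]
    refine IsExtremalGraph.of_turanValue_le hb hq hnpq (by simp [hnpq])
      ((smallEdgeNeighborhoods_disjointCopies _ (by simp)).sum
        (smallEdgeNeighborhoods_of_card_le (by simp; omega))) ?_
    rw [card_edgeFinset_disjointSum, card_edgeFinset_disjointCopies_complete, hval]
    have : (completeGraph (Fin q)).edgeFinset.card = q.choose 2 := by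
      simpa using card_edgeFinset_top_eq_card_choose_two (V := Fin q)
    rw [this]
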